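/- Let $X$ be a complex Banach space, $\mathbb R_+=[0,\infty)$, $\mathbb C_\pm=\{\lambda\in\mathbb C:\pm\operatorname{Re}\lambda>0\}$, and for $J\in\{\mathbb R_+,\mathbb R\}$ let $BUC(J,X)$ be the space of bounded uniformly continuous functions $J\to X$ with the supremum norm. For a function $\phi$ on $J$ and $s\in J$ put $\phi_s(t)=\phi(t+s)$. For $\phi\in L^\infty(\mathbb R_+,X)$ let $\mathcal L\phi(\lambda)=\int_0^\infty e^{-\lambda t}\phi(t)\,dt$ for $\lambda\in\mathbb C_+$. For $\phi\in L^\infty(\mathbb R,X)$ let $\mathcal C\phi(\lambda)=\int_0^\infty e^{-\lambda t}\phi(t)\,dt$ for $\lambda\in\mathbb C_+$ and $\mathcal C\phi(\lambda)=-\int_0^\infty e^{\lambda t}\phi(-t)\,dt$ for $\lambda\in\mathbb C_-$. The functions $\mathcal L_u\phi(\lambda)(s)=\mathcal L\phi_s(\lambda)$ ($s\in\mathbb R_+$) and $\mathcal C_u\phi(\lambda)(s)=\mathcal C\phi_s(\lambda)$ ($s\in\mathbb R$) define maps $\mathcal L_u\phi:\mathbb C_+\to BUC(\mathbb R_+,X)$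 and $\mathcal C_u\phi:\mathbb C\setminus i\mathbb R\to BUC(\mathbb R,X)$. For a function $\zeta$ on $\Sigma=\mathbb C_+$ or $\Sigma=\mathbb C\setminus i\mathbb R$ with values in a complex Banach space, a point $i\omega$ ($\omega\in\mathbb R$) is called regular for $\zeta$ if there are an open neighbourhood $V$ of $i\omega$ and a holomorphic function on $V$ that coincides with $\zeta$ on $V\cap\Sigma$; otherwise $i\omega$ is called singular for $\zeta$. Let $sp^{\mathcal L}(\phi)$, $sp^{\mathcal C}(\phi)$, $sp^{\mathcal L_u}(\phi)$, $sp^{\mathcal C_u}(\phi)$ be the sets of all $\omega\in\mathbb R$ such that $i\omega$ is singular for $\mathcal L\phi$, $\mathcal C\phi$, $\mathcal L_u\phi$, $\mathcal C_u\phi$ respectively (the Laplace or half-line spectrum, the Carleman spectrum, the uniform Laplace spectrum, and the uniform Carleman spectrum). Then $sp^{\mathcal L}(\phi)=sp^{\mathcal L_u}(\phi)$ for every $\phi\in L^\infty(\mathbb R_+,X)$, and $sp^{\mathcal C}(\phi)=sp^{\mathcal C_u}(\phi)$ for every $\phi\in L^\infty(\mathbb R,X)$. -/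

import Mathlib

open MeasureTheory Set
open scoped NNReal ENNReal BoundedContinuousFunction

noncomputable section

namespace UniformSpectra

set_option linter.unusedSectionVars false

/-- `BUC(J, X)`: the bounded uniformly continuous functions `J → X` with the supremum norm
(inherited from the Banach space of bounded continuous functions). -/
def BUC (J X : Type*) [PseudoMetricSpace J] [NormedAddCommGroup X] [NormedSpace ℂ X] :
    Submodule ℂ (J →ᵇ X) where
  carrier := {f | UniformContinuous f}
  add_mem' {f g} hf hg := by
    have h1 : UniformContinuous f := hf
    have h2 : UniformContinuous g := hg
    exact h1.add h2
  zero_mem' := (uniformContinuous_const : UniformContinuous fun _ : J => (0 : X))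
  smul_mem' c {f} hf := by
    have h1 : UniformContinuous f := hf
    exact h1.const_smul c

/-- The open right half-plane `ℂ₊`. -/
def rightHalfPlane : Set ℂ := {z | 0 < z.re}

/-- The complement `ℂ \ iℝ` of the imaginary axis. -/
def offImaginaryAxis : Set ℂ := {z | z.re ≠ 0}

/-- `w` is a regular point of `ζ : D → E` if `ζ` has an extension that is holomorphic in an
open neighbourhood `V` of `w`. -/
def IsRegularPoint {E : Type*} [NormedAddCommGroup E] [NormedSpace ℂ E] {D : Set ℂ}
    (ζ : D → E) (w : ℂ) : Prop :=
  ∃ V : Set ℂ, IsOpen V ∧ w ∈ V ∧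
    ∃ g : ℂ → E, DifferentiableOn ℂ g V ∧ ∀ z : D, (z : ℂ) ∈ V → g z = ζ z

/-- The set of real `ω` such that `iω` is a singular (i.e. not regular) point of `ζ`. -/
def singularSet {E : Type*} [NormedAddCommGroup E] [NormedSpace ℂ E] {D : Set ℂ}
    (ζ : D → E) : Set ℝ :=
  {ω | ¬ IsRegularPoint ζ (Complex.I * (ω : ℂ))}

variable {X : Type*} [NormedAddCommGroup X] [NormedSpace ℂ X]

/-- The translate `φ_s(t) = φ(t + s)`. -/
def translate (φ : ℝ → X) (s : ℝ) : ℝ → X := fun t => φ (t + s)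

/-- The integral `∫₀^∞ e^{-zt} φ(t) dt`. -/
def laplaceIntegral (φ : ℝ → X) (z : ℂ) : X :=
  ∫ t in Ioi (0 : ℝ), Complex.exp (-z * (t : ℂ)) • φ t

/-- The Laplace transform on `ℂ₊`. -/
def laplaceTransform (φ : ℝ → X) (z : rightHalfPlane) : X :=
  laplaceIntegral φ z

open Classical in
/-- The Carleman transform on `ℂ \ iℝ`: `∫₀^∞ e^{-zt} φ(t) dt` if `Re z > 0`, and
`-∫₀^∞ e^{zt} φ(-t) dt` if `Re z < 0`. -/
def carlemanTransform (φ : ℝ → X) (z : offImaginaryAxis) : X :=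
  if 0 < (z : ℂ).re then ∫ t in Ioi (0 : ℝ), Complex.exp (-(z : ℂ) * (t : ℂ)) • φ t
  else -∫ t in Ioi (0 : ℝ), Complex.exp ((z : ℂ) * (t : ℂ)) • φ (-t)

/-- The Laplace (half-line) spectrum. -/
def laplaceSpectrum (φ : ℝ → X) : Set ℝ := singularSet (laplaceTransform φ)

/-- The Carleman spectrum. -/
def carlemanSpectrum (φ : ℝ → X) : Set ℝ := singularSet (carlemanTransform φ)

/-- `L^∞(ℝ₊, X)`, for Lebesgue measure on `ℝ₊ = [0, ∞)`. -/
abbrev LInftyHalfLine (X : Type*) [NormedAddCommGroup X] : Type _ :=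
  Lp X ∞ ((volume : Measure ℝ).restrict (Ici 0))

/-- `L^∞(ℝ, X)`, for Lebesgue measure on `ℝ`. -/
abbrev LInftyLine (X : Type*) [NormedAddCommGroup X] : Type _ :=
  Lp X ∞ (volume : Measure ℝ)

/-! The next lemmas show that `s ↦ ℒφ_s(z)` and `s ↦ 𝒞φ_s(z)` belong to `BUC`. -/

theorem norm_exp_sub_one_le {w : ℂ} (hw : w.re ≤ 0) : ‖Complex.exp w - 1‖ ≤ 2 * ‖w‖ := by
  rcases le_total ‖w‖ 1 with h | h
  · exact Complex.norm_exp_sub_one_le h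
  · have h1 : ‖Complex.exp w‖ ≤ 1 := by
      rw [Complex.norm_exp]; exact Real.exp_le_one_iff.2 hw
    have h2 := norm_sub_le (Complex.exp w) 1
    rw [norm_one] at h2
    linarith

theorem norm_kernel (z : ℂ) (t : ℝ) : ‖Complex.exp (-z * (t : ℂ))‖ = Real.exp (-z.re * t) := by
  rw [Complex.norm_exp]; simp

theorem integrable_kernel {z : ℂ} (hz : 0 < z.re) {φ : ℝ → X} {M : ℝ}
    (hm : AEStronglyMeasurable φ (volume.restrict (Ioi 0)))
    (hb : ∀ᵐ t ∂(volume.restrict (Ioi (0 : ℝ))), ‖φ t‖ ≤ M) :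
    IntegrableOn (fun t : ℝ => Complex.exp (-z * (t : ℂ)) • φ t) (Ioi 0) := by
  have h1 : IntegrableOn (fun t : ℝ => Real.exp (-z.re * t) * M) (Ioi 0) :=
    (integrableOn_exp_mul_Ioi (by linarith) 0).mul_const M
  refine Integrable.mono' h1 ?_ ?_
  · exact (Continuous.aestronglyMeasurable (by fun_prop)).smul hm
  · filter_upwards [hb] with t ht
    rw [norm_smul, norm_kernel]
    gcongr

theorem norm_laplaceIntegral_le {z : ℂ} (hz : 0 < z.re) {φ : ℝ → X} {M : ℝ}
    (hb : ∀ᵐ t ∂(volume.restrict (Ioi (0 : ℝ))), ‖φ t‖ ≤ M) :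
    ‖laplaceIntegral φ z‖ ≤ M / z.re := by
  have h1 : IntegrableOn (fun t : ℝ => Real.exp (-z.re * t) * M) (Ioi 0) :=
    (integrableOn_exp_mul_Ioi (by linarith) 0).mul_const M
  refine (norm_integral_le_of_norm_le h1 ?_).trans (le_of_eq ?_)
  · filter_upwards [hb] with t ht
    rw [norm_smul, norm_kernel]
    gcongr
  · rw [integral_mul_const, integral_exp_mul_Ioi (by linarith)]
    simp
    ring

theorem ae_translate {p : ℝ → Prop} {a s : ℝ} (has : a ≤ s)
    (h : ∀ᵐ t ∂(volume.restrict (Ici a)), p t) :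
    ∀ᵐ t ∂(volume.restrict (Ioi (0 : ℝ))), p (t + s) := by
  rw [ae_restrict_iff' measurableSet_Ici] at h
  rw [ae_restrict_iff' measurableSet_Ioi]
  have := (measurePreserving_add_right (volume : Measure ℝ) s).quasiMeasurePreserving.ae h
  filter_upwards [this] with t ht ht0
  exact ht (by simp only [mem_Ioi] at ht0; simp only [mem_Ici]; linarith)

theorem aestronglyMeasurable_translate {φ : ℝ → X} {a s : ℝ} (has : a ≤ s)
    (h : AEStronglyMeasurable φ (volume.restrict (Ici a))) :
    AEStronglyMeasurable (translate φ s) (volume.restrict (Ioi 0)) := by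
  obtain ⟨ψ, hψ, he⟩ := h
  exact ⟨translate ψ s, hψ.comp_measurable (measurable_add_const s), ae_translate has he⟩

theorem laplaceIntegral_translate_sub_le {z : ℂ} (hz : 0 < z.re) {φ : ℝ → X} {M a s h : ℝ}
    (has : a ≤ s) (hh : 0 ≤ h)
    (hm : AEStronglyMeasurable φ (volume.restrict (Ici a)))
    (hb : ∀ᵐ t ∂(volume.restrict (Ici a)), ‖φ t‖ ≤ M) :
    ‖laplaceIntegral (translate φ s) z - laplaceIntegral (translate φ (s + h)) z‖ ≤
      (M + 2 * ‖z‖ * (M / z.re)) * h := by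
  have hi := integrable_kernel hz (aestronglyMeasurable_translate has hm) (ae_translate has hb)
  have hb' := norm_laplaceIntegral_le hz (φ := translate φ (s + h))
    (ae_translate (show a ≤ s + h by linarith) hb)
  have hsplit : laplaceIntegral (translate φ s) z =
      (∫ t in Ioc (0 : ℝ) h, Complex.exp (-z * (t : ℂ)) • translate φ s t) +
        ∫ t in Ioi h, Complex.exp (-z * (t : ℂ)) • translate φ s t := by
    rw [laplaceIntegral, ← Ioc_union_Ioi_eq_Ioi hh]
    refine setIntegral_union ?_ measurableSet_Ioi (hi.mono_set ?_) (hi.mono_set ?_)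
    · exact Set.Ioc_disjoint_Ioi le_rfl
    · exact Ioc_subset_Ioi_self
    · exact Ioi_subset_Ioi hh
  have hshift : (∫ t in Ioi h, Complex.exp (-z * (t : ℂ)) • translate φ s t) =
      Complex.exp (-z * (h : ℂ)) • laplaceIntegral (translate φ (s + h)) z := by
    have := (measurePreserving_add_right (volume : Measure ℝ) h).setIntegral_preimage_emb
      (measurableEmbedding_addRight h)
      (fun t : ℝ => Complex.exp (-z * (t : ℂ)) • translate φ s t) (Ioi h)
    rw [Set.preimage_add_const_Ioi, sub_self] at this
    rw [← this, laplaceIntegral, ← integral_smul]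
    refine integral_congr_ae (Filter.Eventually.of_forall fun t => ?_)
    simp only [translate]
    rw [smul_smul, ← Complex.exp_add]
    congr 2
    · push_cast; ring
    · ring
  have hA : ‖∫ t in Ioc (0 : ℝ) h, Complex.exp (-z * (t : ℂ)) • translate φ s t‖ ≤ M * h := by
    have := norm_setIntegral_le_of_norm_le_const_ae' (μ := volume) (s := Ioc (0 : ℝ) h) (C := M)
      (f := fun t : ℝ => Complex.exp (-z * (t : ℂ)) • translate φ s t) (by simp) ?_
    · simpa [Measure.real, hh] using this
    · have h2 := ae_translate has hb
      rw [ae_restrict_iff' measurableSet_Ioi] at h2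
      filter_upwards [h2] with t ht ht0
      have h3 : ‖translate φ s t‖ ≤ M := ht ht0.1
      rw [norm_smul, norm_kernel]
      have h4 : Real.exp (-z.re * t) ≤ 1 := Real.exp_le_one_iff.2 (by nlinarith [ht0.1])
      calc _ ≤ 1 * ‖translate φ s t‖ := by gcongr
        _ ≤ M := by linarith
  have hE : ‖Complex.exp (-z * (h : ℂ)) - 1‖ ≤ 2 * (‖z‖ * h) := by
    have := norm_exp_sub_one_le (w := -z * (h : ℂ)) (by simp; positivity)
    simpa [abs_of_nonneg hh] using this
  rw [hsplit, hshift]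
  set A := ∫ t in Ioc (0 : ℝ) h, Complex.exp (-z * (t : ℂ)) • translate φ s t
  set u := laplaceIntegral (translate φ (s + h)) z
  have : A + Complex.exp (-z * (h : ℂ)) • u - u = A + (Complex.exp (-z * (h : ℂ)) - 1) • u := by
    rw [sub_smul, one_smul]; abel
  rw [this]
  calc _ ≤ ‖A‖ + ‖(Complex.exp (-z * (h : ℂ)) - 1) • u‖ := norm_add_le _ _
    _ ≤ M * h + 2 * (‖z‖ * h) * (M / z.re) := by
      rw [norm_smul]; gcongr
    _ = _ := by ring

theorem dist_laplaceIntegral_translate_le {z : ℂ} (hz : 0 < z.re) {φ : ℝ → X} {M a s s' : ℝ}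
    (has : a ≤ s) (has' : a ≤ s')
    (hm : AEStronglyMeasurable φ (volume.restrict (Ici a)))
    (hb : ∀ᵐ t ∂(volume.restrict (Ici a)), ‖φ t‖ ≤ M) :
    dist (laplaceIntegral (translate φ s) z) (laplaceIntegral (translate φ s') z) ≤
      (M + 2 * ‖z‖ * (M / z.re)) * dist s s' := by
  wlog hss : s ≤ s' generalizing s s'
  · rw [dist_comm, dist_comm s]
    exact this has' has (le_of_not_ge hss)
  · have := laplaceIntegral_translate_sub_le hz has (sub_nonneg.2 hss) hm hb
    rw [add_sub_cancel] at this
    rwa [dist_eq_norm, dist_comm s, Real.dist_eq, abs_of_nonneg (sub_nonneg.2 hss)]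

/-- A bounded uniformly continuous function as an element of `BUC`. -/
def mkBUC {J : Type*} [PseudoMetricSpace J] (u : J → X) (h : UniformContinuous u ∧ ∃ C, ∀ s, ‖u s‖ ≤ C) :
    BUC J X :=
  ⟨BoundedContinuousFunction.ofNormedAddCommGroup u h.1.continuous h.2.choose h.2.choose_spec, h.1⟩

theorem ae_norm_le_of_Lp {μ : Measure ℝ} (φ : Lp X ∞ μ) :
    ∀ᵐ t ∂μ, ‖φ t‖ ≤ (eLpNorm φ ∞ μ).toReal := by
  have hf := (Lp.memLp φ).eLpNorm_lt_top.ne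
  have h1 : ∀ᵐ t ∂μ, ‖φ t‖ₑ ≤ eLpNorm φ ∞ μ := by
    rw [eLpNorm_exponent_top]
    exact enorm_ae_le_eLpNormEssSup _ _
  filter_upwards [h1] with t ht
  rw [← toReal_enorm]
  exact ENNReal.toReal_mono hf ht

theorem uniformContinuous_of_dist_le {J : Type*} [PseudoMetricSpace J] {u : J → X} {K : ℝ}
    (h : ∀ s s', dist (u s) (u s') ≤ K * dist s s') : UniformContinuous u :=
  (LipschitzWith.of_dist_le' h).uniformContinuous

theorem laplaceTransform_translate_mem (φ : LInftyHalfLine X) (z : rightHalfPlane) :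
    UniformContinuous (fun s : ℝ≥0 => laplaceTransform (translate φ s) z) ∧
      ∃ C, ∀ s : ℝ≥0, ‖laplaceTransform (translate φ s) z‖ ≤ C := by
  have hz : 0 < (z : ℂ).re := z.2
  set M := (eLpNorm φ ∞ ((volume : Measure ℝ).restrict (Ici 0))).toReal
  have hb : ∀ᵐ t ∂(volume.restrict (Ici (0 : ℝ))), ‖φ t‖ ≤ M := ae_norm_le_of_Lp φ
  have hm := Lp.aestronglyMeasurable φ
  refine ⟨uniformContinuous_of_dist_le (K := M + 2 * ‖(z : ℂ)‖ * (M / (z : ℂ).re)) fun s s' => ?_, M / (z : ℂ).re, fun s => ?_⟩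
  · exact dist_laplaceIntegral_translate_le hz s.2 s'.2 hm hb
  · exact norm_laplaceIntegral_le hz (ae_translate (p := fun t => ‖φ t‖ ≤ _) s.2 hb)

theorem line_mem {z : ℂ} (hz : 0 < z.re) {φ : ℝ → X} {M : ℝ}
    (hm : AEStronglyMeasurable φ volume) (hb : ∀ᵐ t : ℝ, ‖φ t‖ ≤ M) :
    UniformContinuous (fun s : ℝ => laplaceIntegral (translate φ s) z) ∧
      ∃ C, ∀ s : ℝ, ‖laplaceIntegral (translate φ s) z‖ ≤ C := by
  refine ⟨uniformContinuous_of_dist_le (K := M + 2 * ‖z‖ * (M / z.re)) fun s s' => ?_, M / z.re, fun s => ?_⟩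
  · exact dist_laplaceIntegral_translate_le hz (min_le_left s s') (min_le_right s s')
      hm.restrict (ae_restrict_of_ae hb)
  · exact norm_laplaceIntegral_le hz
      (ae_translate (p := fun t => ‖φ t‖ ≤ _) (le_refl s) (ae_restrict_of_ae hb))

theorem carlemanTransform_translate_mem (φ : LInftyLine X) (z : offImaginaryAxis) :
    UniformContinuous (fun s : ℝ => carlemanTransform (translate φ s) z) ∧
      ∃ C, ∀ s : ℝ, ‖carlemanTransform (translate φ s) z‖ ≤ C := by
  have hb := ae_norm_le_of_Lp φ
  have hm := Lp.aestronglyMeasurable φ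
  by_cases hz : 0 < (z : ℂ).re
  · simp only [carlemanTransform, if_pos hz]
    exact line_mem hz hm hb
  · have hz' : 0 < (-(z : ℂ)).re := by
      have h0 : (z : ℂ).re ≠ 0 := z.2
      rw [Complex.neg_re, neg_pos]
      exact lt_of_le_of_ne (not_lt.1 hz) h0
    have hq := (Measure.measurePreserving_neg (volume : Measure ℝ)).quasiMeasurePreserving
    obtain ⟨h1, C, h2⟩ := line_mem hz' (φ := fun t => φ (-t))
      (hm.comp_quasiMeasurePreserving hq) (hq.ae hb)
    have key : ∀ s : ℝ, carlemanTransform (translate φ s) z =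
        -laplaceIntegral (translate (fun t => φ (-t)) (-s)) (-(z : ℂ)) := by
      intro s
      rw [carlemanTransform, if_neg hz, laplaceIntegral]
      simp [translate, neg_add_rev, add_comm]
    simp only [key]
    refine ⟨(h1.comp uniformContinuous_neg).neg, C, fun s => ?_⟩
    rw [norm_neg]
    exact h2 (-s)

/-- The uniform Laplace transform `z ↦ (s ↦ ℒφ_s(z))`, a map `ℂ₊ → BUC(ℝ₊, X)`. -/
def uniformLaplaceTransform (φ : LInftyHalfLine X) (z : rightHalfPlane) : BUC ℝ≥0 X :=
  mkBUC (fun s : ℝ≥0 => laplaceTransform (translate φ s) z) (laplaceTransform_translate_mem φ z)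

/-- The uniform Carleman transform `z ↦ (s ↦ 𝒞φ_s(z))`, a map `ℂ \ iℝ → BUC(ℝ, X)`. -/
def uniformCarlemanTransform (φ : LInftyLine X) (z : offImaginaryAxis) : BUC ℝ X :=
  mkBUC (fun s : ℝ => carlemanTransform (translate φ s) z) (carlemanTransform_translate_mem φ z)

/-- The uniform Laplace spectrum. -/
def uniformLaplaceSpectrum (φ : LInftyHalfLine X) : Set ℝ :=
  singularSet (uniformLaplaceTransform φ)

/-- The uniform Carleman spectrum. -/
def uniformCarlemanSpectrum (φ : LInftyLine X) : Set ℝ :=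
  singularSet (uniformCarlemanTransform φ)

end UniformSpectra

end

noncomputable section

namespace UniformSpectra

variable {X : Type*} [NormedAddCommGroup X] [NormedSpace ℂ X]

/-! Evaluation at `s = 0` gives one inclusion in each case. For the converse, let `g` extend the
transform of `φ` holomorphically near `iω`. Off the axis the transform of `φ_s` at `z` is `e^{zs} (c
- ∫₀ˢ e^{-zt} φ(t) dt)`, where `c` is the transform of `φ`. Everything but `c` is entire in `z`, so
putting `g z` for `c` extends all translates to one common neighbourhood (`shiftedTransform`).

It remains to make these extensions uniform in `s`. Off the axis they are `O(1 / |Re z|)` uniformly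
in `s`, and a maximum principle with a multiplier vanishing where the circle meets the axis turns
this into a uniform bound on a smaller disc (`norm_le_of_abs_re_mul_norm_le`). Boundedness in `s`
forces a Lipschitz estimate in `s`, so the values lie in `BUC` even on the axis
(`dist_shiftedTransform_le`). A bounded, pointwise holomorphic family is holomorphic in the norm of
`BUC` (`differentiableOn_BUC`). -/

/-! ### A maximum principle across the imaginary axis. -/

open Metric in
/-- A holomorphic function on a disc centred on the imaginary axis that grows at most like
`K / |Re z|` is bounded on a smaller disc, by a constant depending only on `K` and the radius. -/
theorem norm_le_of_abs_re_mul_norm_le {f : ℂ → X} {w z : ℂ} {R K : ℝ} (hR : 0 < R)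
    (hw : w.re = 0) (hf : DifferentiableOn ℂ f (ball w R))
    (hK : ∀ z ∈ ball w R, |z.re| * ‖f z‖ ≤ K) (hz : z ∈ ball w (R / 4)) :
    ‖f z‖ ≤ 16 * K / (3 * R) := by
  set r := R / 2 with hr
  have hr0 : 0 < r := by positivity
  have hsub : closedBall w r ⊆ ball w R := closedBall_subset_ball (by linarith)
  -- The multiplier has modulus `2 r |Re z|` on the circle of radius `r`, cancelling the growth of
  -- `f`, and at least `3 r² / 4` on the disc of radius `r / 2 = R / 4`.
  have hd : DiffContOnCl ℂ (fun z => ((r : ℂ) ^ 2 + (z - w) ^ 2) • f z) (ball w r) := by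
    refine DifferentiableOn.diffContOnCl ?_
    rw [closure_ball _ hr0.ne']
    exact DifferentiableOn.smul (by fun_prop) (hf.mono hsub)
  have hmax := Complex.norm_le_of_forall_mem_frontier_norm_le isBounded_ball hd (C := 2 * r * K)
    (fun u hu => ?_) (z := z) (subset_closure (ball_subset_ball (by linarith) hz))
  · have hzr : ‖z - w‖ < r / 2 := by
      rw [mem_ball, dist_eq_norm] at hz; linarith
    have hlow : 3 / 4 * r ^ 2 ≤ ‖(r : ℂ) ^ 2 + (z - w) ^ 2‖ := by
      have h1 := norm_sub_le_norm_add ((r : ℂ) ^ 2) ((z - w) ^ 2)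
      rw [norm_pow, norm_pow, Complex.norm_real, Real.norm_of_nonneg hr0.le] at h1
      nlinarith [norm_nonneg (z - w)]
    rw [norm_smul] at hmax
    have h2 : 3 / 4 * r ^ 2 * ‖f z‖ ≤ 2 * r * K :=
      (mul_le_mul_of_nonneg_right hlow (norm_nonneg _)).trans hmax
    have hRr : R = 2 * r := by linarith
    rw [hRr, le_div_iff₀ (by positivity)]
    have h3 : r * (‖f z‖ * (3 * (2 * r))) ≤ r * (16 * K) := by nlinarith
    exact le_of_mul_le_mul_left h3 hr0
  · rw [frontier_ball _ hr0.ne'] at hu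
    have hur : ‖u - w‖ = r := mem_sphere_iff_norm.1 hu
    -- On the circle `r²` is `(u - w)` times its conjugate, and the conjugate plus `u - w` is `2 Re
    -- u`.
    have hfac : (r : ℂ) ^ 2 + (u - w) ^ 2 = (u - w) * ((2 * u.re : ℝ) : ℂ) := by
      have h1 := Complex.mul_conj (u - w)
      rw [Complex.normSq_eq_norm_sq, hur] at h1
      have h2 := Complex.add_conj (u - w)
      rw [Complex.sub_re, hw, sub_zero] at h2
      rw [← h2, mul_add, h1]
      push_cast
      ring
    rw [norm_smul, hfac, norm_mul, hur, Complex.norm_real, Real.norm_eq_abs, abs_mul, abs_two]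
    have := hK u (hsub (sphere_subset_closedBall hu))
    nlinarith

/-! ### Holomorphy of `BUC`-valued functions. -/

theorem isClosed_BUC (J : Type*) [PseudoMetricSpace J] :
    IsClosed (BUC J X : Set (J →ᵇ X)) := by
  refine IsSeqClosed.isClosed fun u f hu hf => ?_
  exact (BoundedContinuousFunction.tendsto_iff_tendstoUniformly.1 hf).uniformContinuous
    (Filter.Frequently.of_forall hu)

instance completeSpace_BUC (J : Type*) [PseudoMetricSpace J] [CompleteSpace X] :
    CompleteSpace (BUC J X) :=
  (isClosed_BUC J).completeSpace_coe

/-- Evaluation at `s` as a continuous linear map on `BUC`. -/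
def evalBUC {J : Type*} [PseudoMetricSpace J] (s : J) : BUC J X →L[ℂ] X :=
  (BoundedContinuousFunction.evalCLM ℂ s).comp (BUC J X).subtypeL

theorem evalBUC_apply {J : Type*} [PseudoMetricSpace J] (s : J) (f : BUC J X) :
    evalBUC s f = (f : J →ᵇ X) s := rfl

theorem ext_evalBUC {J : Type*} [PseudoMetricSpace J] {f g : BUC J X}
    (h : ∀ s, evalBUC s f = evalBUC s g) : f = g :=
  Subtype.ext (BoundedContinuousFunction.ext h)

theorem evalBUC_mkBUC {J : Type*} [PseudoMetricSpace J] (u : J → X)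
    (h : UniformContinuous u ∧ ∃ C, ∀ s, ‖u s‖ ≤ C) (s : J) : evalBUC s (mkBUC u h) = u s := rfl

theorem dist_BUC_le {J : Type*} [PseudoMetricSpace J] {f g : BUC J X} {C : ℝ} (hC : 0 ≤ C)
    (h : ∀ s, dist (evalBUC s f) (evalBUC s g) ≤ C) : dist f g ≤ C :=
  (BoundedContinuousFunction.dist_le hC).2 h

open Metric in
/-- A `BUC`-valued function that is uniformly bounded on a disc and pointwise holomorphic there
is holomorphic on a smaller disc. -/
theorem differentiableOn_BUC [CompleteSpace X] {J : Type*} [PseudoMetricSpace J]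
    {G : ℂ → BUC J X} {w : ℂ} {R B : ℝ} (hR : 0 < R)
    (hd : ∀ s, DifferentiableOn ℂ (fun z => evalBUC s (G z)) (ball w R))
    (hB : ∀ z ∈ ball w R, ∀ s, ‖evalBUC s (G z)‖ ≤ B) :
    DifferentiableOn ℂ G (ball w (R / 2)) := by
  have hcont : ContinuousOn G (closedBall w (R / 2)) := by
    intro c hc
    refine ContinuousAt.continuousWithinAt ?_
    have hsub : ball c (R / 2) ⊆ ball w R :=
      ball_subset_ball' (by rw [mem_closedBall] at hc; linarith)
    -- The Schwarz lemma at each `s`: values stay within `2 |B|` of the value at the centre, so the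
    -- Lipschitz constant does not depend on `s` and continuity holds in norm.
    have hlip : ∀ z ∈ ball c (R / 2), dist (G z) (G c) ≤ 2 * |B| / (R / 2) * dist z c := by
      intro z hz
      refine dist_BUC_le (by positivity) fun s => ?_
      refine Complex.dist_le_div_mul_dist_of_mapsTo_ball ((hd s).mono hsub) (fun v hv => ?_) hz
      rw [mem_closedBall, dist_eq_norm]
      have h1 := hB v (hsub hv) s
      have h2 := hB c (hsub (mem_ball_self (by positivity))) s
      have h3 := le_abs_self B
      exact (norm_sub_le _ _).trans (by linarith)
    refine tendsto_iff_dist_tendsto_zero.2 ?_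
    refine squeeze_zero' (.of_forall fun _ => dist_nonneg)
      (Filter.eventually_of_mem (ball_mem_nhds c (by positivity)) hlip) ?_
    have : Continuous fun z => 2 * |B| / (R / 2) * dist z c := by fun_prop
    simpa using this.tendsto c
  have hint : CircleIntegrable G w (R / 2) :=
    (hcont.mono sphere_subset_closedBall).circleIntegrable (by positivity)
  lift R to ℝ≥0 using hR.le
  have hR2 : ((R / 2 : ℝ≥0) : ℝ) = (R : ℝ) / 2 := by simp
  rw [← hR2] at hint hcont ⊢
  have hR0 : 0 < R / 2 := by exact_mod_cast (half_pos hR)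
  -- The Cauchy integral of a norm-continuous function is a convergent power series in `BUC`.
  -- Evaluation commutes with the integral, so the scalar-parameter Cauchy formula at each `s`
  -- identifies it with `G`.
  have hps := (hasFPowerSeriesOn_cauchy_integral hint hR0).differentiableOn
  rw [Metric.eball_coe] at hps
  refine hps.congr fun z hz => ext_evalBUC fun s => ?_
  have hsub : closedBall w (R / 2 : ℝ≥0) ⊆ ball w R :=
    closedBall_subset_ball (by rw [hR2]; exact half_lt_self hR)
  have hcauchy := ((hd s).mono hsub).circleIntegral_sub_inv_smul hz
  have hcomm : evalBUC s (∮ u in C(w, (R / 2 : ℝ≥0)), (u - z)⁻¹ • G u) =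
      ∮ u in C(w, (R / 2 : ℝ≥0)), (u - z)⁻¹ • evalBUC s (G u) := by
    rw [circleIntegral, circleIntegral, ← ContinuousLinearMap.intervalIntegral_comp_comm]
    · simp only [map_smul]
    · refine CircleIntegrable.out (f := fun u => (u - z)⁻¹ • G u) ?_
      refine ContinuousOn.circleIntegrable (by positivity) ?_
      refine ContinuousOn.smul (f := fun u : ℂ => (u - z)⁻¹) ?_
        (hcont.mono sphere_subset_closedBall)
      refine ContinuousOn.inv₀ (by fun_prop) fun u hu => sub_ne_zero.2 ?_
      rintro rfl
      exact (mem_ball.1 hz).ne (mem_sphere.1 hu)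
  rw [map_smul, hcomm, hcauchy, inv_smul_smul₀]
  simp [Real.pi_ne_zero]

open Metric in
/-- Regularity of a `BUC`-valued function at a point of the imaginary axis from a family of
pointwise extensions that are controlled uniformly by `K / |Re z|`. -/
theorem isRegularPoint_BUC [CompleteSpace X] {J : Type*} [PseudoMetricSpace J] {D : Set ℂ}
    {ζ : D → BUC J X} {F : J → ℂ → X} {w : ℂ} {R K : ℝ} (hR : 0 < R) (hw : w.re = 0)
    (hd : ∀ s, DifferentiableOn ℂ (F s) (ball w R))
    (hK : ∀ s, ∀ z ∈ ball w R, |z.re| * ‖F s z‖ ≤ K)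
    (huc : ∀ z ∈ ball w R, (∃ C, ∀ s, ‖F s z‖ ≤ C) → UniformContinuous fun s => F s z)
    (hζ : ∀ z : D, (z : ℂ) ∈ ball w R → ∀ s, evalBUC s (ζ z) = F s z) :
    IsRegularPoint ζ w := by
  classical
  have hsub : ball w (R / 4) ⊆ ball w R := ball_subset_ball (by linarith)
  have hB : ∀ z ∈ ball w (R / 4), ∀ s, ‖F s z‖ ≤ 16 * K / (3 * R) := fun z hz s =>
    norm_le_of_abs_re_mul_norm_le hR hw (hd s) (hK s) hz
  -- The bound `hB` comes first, since `huc` gives uniform continuity only for bounded values. The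
  -- value `0` off the disc is never used.
  let G : ℂ → BUC J X := fun z =>
    if hz : z ∈ ball w (R / 4) then
      mkBUC (fun s => F s z) ⟨huc z (hsub hz) ⟨_, hB z hz⟩, ⟨_, hB z hz⟩⟩
    else 0
  have hG : ∀ z ∈ ball w (R / 4), ∀ s, evalBUC s (G z) = F s z := by
    intro z hz s
    simp only [G, dif_pos hz, evalBUC_mkBUC]
  have hsub' : ball w (R / 4 / 2) ⊆ ball w (R / 4) := ball_subset_ball (by linarith)
  refine ⟨ball w (R / 4 / 2), isOpen_ball, mem_ball_self (by positivity), G,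
    differentiableOn_BUC (B := 16 * K / (3 * R)) (by positivity) (fun s => ?_)
      (fun z hz s => ?_), fun z hz => ext_evalBUC fun s => ?_⟩
  · exact ((hd s).mono hsub).congr fun z hz => hG z hz s
  · rw [hG z hz]; exact hB z hz s
  · rw [hG _ (hsub' hz), hζ z (hsub (hsub' hz))]

theorem IsRegularPoint.of_evalBUC {J : Type*} [PseudoMetricSpace J] {D : Set ℂ}
    {ζ : D → BUC J X} {w : ℂ} (h : IsRegularPoint ζ w) (s : J) :
    IsRegularPoint (fun z => evalBUC s (ζ z)) w := by
  obtain ⟨V, hV, hwV, g, hg, hgζ⟩ := h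
  exact ⟨V, hV, hwV, fun z => evalBUC s (g z), (evalBUC s).differentiable.comp_differentiableOn hg,
    fun z hz => congrArg (evalBUC s) (hgζ z hz)⟩

/-! ### Transforms of translates and their continuation. -/

theorem intervalIntegrable_kernel {ψ : ℝ → X} {M : ℝ} (hm : AEStronglyMeasurable ψ)
    (hb : ∀ᵐ t, ‖ψ t‖ ≤ M) (z : ℂ) (a b : ℝ) :
    IntervalIntegrable (fun t : ℝ => Complex.exp (-z * (t : ℂ)) • ψ t) volume a b := by
  have h1 : IntervalIntegrable ψ volume a b := by
    rw [intervalIntegrable_iff]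
    exact Measure.integrableOn_of_bounded (by simp) hm (ae_restrict_of_ae hb)
  exact h1.continuousOn_smul (by fun_prop)

/-- The function `e^{zs} (c - ∫₀ˢ e^{-zt} ψ(t) dt)`: the transform at `z` of the translate `ψ_s`,
expressed through the value `c` of the transform of `ψ`. -/
def shiftedTransform (ψ : ℝ → X) (z : ℂ) (c : X) (s : ℝ) : X :=
  Complex.exp (z * s) • (c - ∫ t in (0 : ℝ)..s, Complex.exp (-z * (t : ℂ)) • ψ t)

/-- The substitution `t ↦ t + s` gives `e^{zs}` times the integral over `(s, ∞)`, which is the full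
integral minus the one over `(0, s]`, with the oriented integral covering negative `s`. -/
theorem laplaceIntegral_translate_eq {ψ : ℝ → X} {M : ℝ} (hm : AEStronglyMeasurable ψ)
    (hb : ∀ᵐ t, ‖ψ t‖ ≤ M) {z : ℂ} (hz : 0 < z.re) (s : ℝ) :
    laplaceIntegral (translate ψ s) z = shiftedTransform ψ z (laplaceIntegral ψ z) s := by
  have hshift : ∀ s : ℝ, (fun t : ℝ => Complex.exp (-z * (t : ℂ)) • translate ψ s t) =
      fun t : ℝ => Complex.exp (z * s) • (Complex.exp (-z * ((t + s : ℝ) : ℂ)) • ψ (t + s)) := by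
    intro s
    ext t
    rw [smul_smul, ← Complex.exp_add, translate]
    congr 2
    push_cast; ring
  have hmp := fun s : ℝ => measurePreserving_add_right (volume : Measure ℝ) s
  have hint : ∀ s : ℝ, IntegrableOn (fun t : ℝ => Complex.exp (-z * (t : ℂ)) • ψ t) (Ioi s) := by
    intro s
    have h1 := integrable_kernel hz (aestronglyMeasurable_translate (le_refl s) hm.restrict)
      (ae_translate (p := fun t => ‖ψ t‖ ≤ M) (le_refl s) (ae_restrict_of_ae hb))
    rw [hshift s] at h1
    replace h1 := (integrable_smul_iff (Complex.exp_ne_zero (z * s))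
      fun t : ℝ => Complex.exp (-z * ((t + s : ℝ) : ℂ)) • ψ (t + s)).1 h1
    have h2 := (hmp s).integrableOn_comp_preimage (measurableEmbedding_addRight s)
      (f := fun t : ℝ => Complex.exp (-z * (t : ℂ)) • ψ t) (s := Ioi s)
    rw [Set.preimage_add_const_Ioi, sub_self] at h2
    exact h2.1 h1
  have h3 := (hmp s).setIntegral_preimage_emb (measurableEmbedding_addRight s)
    (fun t : ℝ => Complex.exp (-z * (t : ℂ)) • ψ t) (Ioi s)
  rw [Set.preimage_add_const_Ioi, sub_self] at h3
  rw [laplaceIntegral, hshift s, integral_smul, h3, shiftedTransform, laplaceIntegral,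
    ← intervalIntegral.integral_interval_add_Ioi (hint 0) (hint s), add_sub_cancel_left]

/-- The negative of the left branch of the Carleman transform, as a Laplace integral. -/
theorem neg_laplaceIntegral_translate_eq {ψ : ℝ → X} {M : ℝ} (hm : AEStronglyMeasurable ψ)
    (hb : ∀ᵐ t, ‖ψ t‖ ≤ M) {z : ℂ} (hz : z.re < 0) (s : ℝ) :
    -laplaceIntegral (translate (fun t => ψ (-t)) (-s)) (-z) =
      shiftedTransform ψ z (-laplaceIntegral (fun t => ψ (-t)) (-z)) s := by
  have hq := (Measure.measurePreserving_neg (volume : Measure ℝ)).quasiMeasurePreserving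
  -- Reflection exchanges the half-planes: apply the right half-plane formula to `ψ(-t)` at `-z` and
  -- `-s`.
  rw [laplaceIntegral_translate_eq (ψ := fun t => ψ (-t)) (hm.comp_quasiMeasurePreserving hq) (hq.ae hb)
    (by simpa using hz) (-s)]
  have h1 := intervalIntegral.integral_comp_neg (a := 0) (b := -s)
    (fun t : ℝ => Complex.exp (-z * (t : ℂ)) • ψ t)
  rw [neg_neg, neg_zero, intervalIntegral.integral_symm 0 s] at h1
  have h2 : (∫ t in (0 : ℝ)..-s, Complex.exp (- -z * (t : ℂ)) • ψ (-t)) =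
      -∫ t in (0 : ℝ)..s, Complex.exp (-z * (t : ℂ)) • ψ t := by
    rw [← h1]
    refine intervalIntegral.integral_congr fun t _ => ?_
    simp
  rw [shiftedTransform, shiftedTransform, h2, ← smul_neg]
  congr 2
  · simp
  · abel

theorem norm_laplaceIntegral_translate_le {ψ : ℝ → X} {M : ℝ} (hb : ∀ᵐ t, ‖ψ t‖ ≤ M) {z : ℂ}
    (hz : 0 < z.re) (s : ℝ) : ‖laplaceIntegral (translate ψ s) z‖ ≤ M / z.re :=
  norm_laplaceIntegral_le hz
    (ae_translate (p := fun t => ‖ψ t‖ ≤ M) (le_refl s) (ae_restrict_of_ae hb))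

theorem norm_neg_laplaceIntegral_translate_le {ψ : ℝ → X} {M : ℝ} (hb : ∀ᵐ t, ‖ψ t‖ ≤ M) {z : ℂ}
    (hz : z.re < 0) (s : ℝ) :
    ‖-laplaceIntegral (translate (fun t => ψ (-t)) (-s)) (-z)‖ ≤ M / -z.re := by
  have hq := (Measure.measurePreserving_neg (volume : Measure ℝ)).quasiMeasurePreserving
  rw [norm_neg, ← Complex.neg_re]
  exact norm_laplaceIntegral_translate_le (hq.ae hb) (by simpa using hz) (-s)

theorem differentiable_integral_kernel {ψ : ℝ → X} {M : ℝ} (hm : AEStronglyMeasurable ψ)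
    (hb : ∀ᵐ t, ‖ψ t‖ ≤ M) (s : ℝ) :
    Differentiable ℂ fun z : ℂ => ∫ t in (0 : ℝ)..s, Complex.exp (-z * (t : ℂ)) • ψ t := by
  intro z
  refine (intervalIntegral.hasDerivAt_integral_of_dominated_loc_of_deriv_le
    (F' := fun z t => (Complex.exp (-z * (t : ℂ)) * -(t : ℂ)) • ψ t)
    -- On the unit disc about `z` one has `|u| ≤ |z| + 1`, and `|t| ≤ |s|` on the interval of
    -- integration.
    (bound := fun _ => Real.exp ((‖z‖ + 1) * |s|) * |s| * M)
    (Metric.ball_mem_nhds z one_pos) (.of_forall fun u => ?_)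
    (intervalIntegrable_kernel hm hb z 0 s) ?_ ?_ (by simp) ?_).2.differentiableAt
  · exact (Continuous.aestronglyMeasurable (by fun_prop)).smul hm.restrict
  · exact (Continuous.aestronglyMeasurable (by fun_prop)).smul hm.restrict
  · filter_upwards [hb] with t ht hts u hu
    have hts' : |t| ≤ |s| := by
      have := Set.abs_sub_left_of_mem_uIcc (uIoc_subset_uIcc hts)
      simpa using this
    have hu' : ‖u‖ ≤ ‖z‖ + 1 := by
      have h1 := norm_sub_norm_le u z
      rw [Metric.mem_ball, dist_eq_norm] at hu
      linarith
    have hre : (-u * (t : ℂ)).re ≤ (‖z‖ + 1) * |s| := by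
      refine (Complex.re_le_norm _).trans ?_
      rw [norm_mul, norm_neg, Complex.norm_real, Real.norm_eq_abs]
      gcongr
    rw [norm_smul, norm_mul, Complex.norm_exp, norm_neg, Complex.norm_real, Real.norm_eq_abs]
    gcongr
  · refine .of_forall fun t _ u _ => ?_
    have h1 : HasDerivAt (fun u : ℂ => -u * (t : ℂ)) (-(t : ℂ)) u := by
      simpa using (hasDerivAt_id u).neg.mul_const (t : ℂ)
    exact h1.cexp.smul_const (ψ t)

theorem differentiableOn_shiftedTransform {ψ : ℝ → X} {M : ℝ} (hm : AEStronglyMeasurable ψ)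
    (hb : ∀ᵐ t, ‖ψ t‖ ≤ M) {g : ℂ → X} {V : Set ℂ} (hg : DifferentiableOn ℂ g V) (s : ℝ) :
    DifferentiableOn ℂ (fun z => shiftedTransform ψ z (g z) s) V :=
  DifferentiableOn.smul (by fun_prop)
    (hg.sub (differentiable_integral_kernel hm hb s).differentiableOn)

/-- As a function of `s` the shifted transform formally solves `f' = z f - ψ`, so a bound on `f`
bounds its derivative. No condition on `Re z` enters, so the estimate is available on the imaginary
axis too. -/
theorem dist_shiftedTransform_le {ψ : ℝ → X} {M : ℝ} (hm : AEStronglyMeasurable ψ)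
    (hb : ∀ᵐ t, ‖ψ t‖ ≤ M) (hM : 0 ≤ M) {z : ℂ} {c : X} {B s s' : ℝ}
    (hs : ‖shiftedTransform ψ z c s‖ ≤ B) (hs' : ‖shiftedTransform ψ z c s'‖ ≤ B) :
    dist (shiftedTransform ψ z c s) (shiftedTransform ψ z c s') ≤
      (Real.exp ‖z‖ * (‖z‖ * B + M) + 2 * B) * dist s s' := by
  wlog hss : s ≤ s' generalizing s s'
  · rw [dist_comm, dist_comm s]
    exact this hs' hs (le_of_not_ge hss)
  obtain ⟨d, hd⟩ : ∃ d, d = s' - s := ⟨_, rfl⟩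
  have hd0 : 0 ≤ d := by linarith
  have hB : 0 ≤ B := (norm_nonneg _).trans hs
  rw [dist_comm s, Real.dist_eq, ← hd, abs_of_nonneg hd0, dist_comm, dist_eq_norm]
  have hK : 0 ≤ Real.exp ‖z‖ * (‖z‖ * B + M) := by positivity
  rcases le_total d 1 with h1 | h1
  · have hsplit : shiftedTransform ψ z c s' - shiftedTransform ψ z c s =
        (Complex.exp (z * d) - 1) • shiftedTransform ψ z c s -
          ∫ t in s..s', (Complex.exp (z * s') * Complex.exp (-z * (t : ℂ))) • ψ t := by
      simp only [mul_smul]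
      rw [intervalIntegral.integral_smul, ← intervalIntegral.integral_interval_sub_left
        (intervalIntegrable_kernel hm hb z 0 s') (intervalIntegrable_kernel hm hb z 0 s),
        sub_smul, one_smul]
      have h2 : Complex.exp (z * d) • shiftedTransform ψ z c s = Complex.exp (z * s') •
          (c - ∫ t in (0 : ℝ)..s, Complex.exp (-z * (t : ℂ)) • ψ t) := by
        rw [shiftedTransform, smul_smul, ← Complex.exp_add, hd]
        congr 2
        push_cast; ring
      rw [h2, shiftedTransform]
      simp only [smul_sub]
      abel
    have hexp : ‖Complex.exp (z * d) - 1‖ ≤ ‖z‖ * d * Real.exp ‖z‖ := by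
      have h2 := Complex.norm_exp_sub_sum_le_norm_mul_exp (z * d) 1
      have h3 : ‖z * (d : ℂ)‖ = ‖z‖ * d := by
        rw [norm_mul, Complex.norm_real, Real.norm_of_nonneg hd0]
      simp only [Finset.range_one, Finset.sum_singleton, pow_zero, Nat.factorial_zero,
        Nat.cast_one, div_one, pow_one, h3] at h2
      refine h2.trans ?_
      gcongr
      nlinarith [norm_nonneg z]
    have hintg : ‖∫ t in s..s', (Complex.exp (z * s') * Complex.exp (-z * (t : ℂ))) • ψ t‖ ≤
        Real.exp ‖z‖ * M * d := by
      have h2 := intervalIntegral.norm_integral_le_of_norm_le_const_ae (a := s) (b := s')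
        (C := Real.exp ‖z‖ * M)
        (f := fun t : ℝ => (Complex.exp (z * s') * Complex.exp (-z * (t : ℂ))) • ψ t) ?_
      · rwa [← hd, abs_of_nonneg hd0] at h2
      · filter_upwards [hb] with t ht hts
        rw [uIoc_of_le hss] at hts
        rw [norm_smul, ← Complex.exp_add, Complex.norm_exp]
        have h3 : (z * s' + -z * (t : ℂ)).re ≤ ‖z‖ := by
          have h4 : z * s' + -z * (t : ℂ) = z * ((s' - t : ℝ) : ℂ) := by push_cast; ring
          refine (Complex.re_le_norm _).trans ?_
          rw [h4, norm_mul, Complex.norm_real, Real.norm_of_nonneg (by linarith [hts.2])]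
          exact mul_le_of_le_one_right (norm_nonneg z) (by linarith [hts.1])
        gcongr
    rw [hsplit]
    calc _ ≤ ‖z‖ * d * Real.exp ‖z‖ * B + Real.exp ‖z‖ * M * d := by
          refine (norm_sub_le _ _).trans (add_le_add ?_ hintg)
          rw [norm_smul]
          gcongr
      _ = Real.exp ‖z‖ * (‖z‖ * B + M) * d := by ring
      _ ≤ _ := by gcongr; linarith
  -- For `d ≥ 1` the trivial bound `2 B` is already at most `2 B d`.
  · calc _ ≤ 2 * B := (norm_sub_le _ _).trans (by linarith)
      _ ≤ 2 * B * d := by nlinarith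
      _ ≤ _ := by gcongr; linarith

open Metric in
/-- A holomorphic extension `g` of the transform of `ψ` near a point of the imaginary axis yields
regularity of the uniform transform, once the shifted transforms grow at most like `1 / |Re z|`. -/
theorem isRegularPoint_of_shiftedTransform [CompleteSpace X] {J : Type*} [PseudoMetricSpace J]
    {ι : J → ℝ} (hι : Isometry ι) {D : Set ℂ} {ζ : D → BUC J X} {ψ : ℝ → X} {M : ℝ}
    (hm : AEStronglyMeasurable ψ) (hb : ∀ᵐ t, ‖ψ t‖ ≤ M) (hM : 0 ≤ M) {w : ℂ} (hw : w.re = 0)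
    {V : Set ℂ} (hV : IsOpen V) (hwV : w ∈ V) {g : ℂ → X} (hg : DifferentiableOn ℂ g V)
    (hbound : ∀ z ∈ V, z.re ≠ 0 → ∀ s : J,
      ‖shiftedTransform ψ z (g z) (ι s)‖ ≤ ‖g z‖ + M / |z.re|)
    (hζ : ∀ z : D, (z : ℂ) ∈ V → ∀ s, evalBUC s (ζ z) = shiftedTransform ψ z (g z) (ι s)) :
    IsRegularPoint ζ w := by
  -- Shrinking the disc until `‖g‖ ≤ ‖g w‖ + 1` and `|Re z| ≤ 1` yields `K = ‖g w‖ + 1 + M`. On the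
  -- axis itself the weight `|Re z|` is zero, so no bound is needed there.
  have hgw : ∀ᶠ z in nhds w, ‖g z‖ < ‖g w‖ + 1 :=
    (hg.differentiableAt (hV.mem_nhds hwV)).continuousAt.norm.eventually_lt_const
      (lt_add_one _)
  obtain ⟨R₀, hR₀, hsub⟩ := Metric.mem_nhds_iff.1 (Filter.inter_mem (hV.mem_nhds hwV) hgw)
  have hsub' : ball w (min R₀ 1) ⊆ ball w R₀ := ball_subset_ball (min_le_left _ _)
  refine isRegularPoint_BUC (F := fun s z => shiftedTransform ψ z (g z) (ι s)) (R := min R₀ 1)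
    (K := ‖g w‖ + 1 + M) (by positivity) hw
    (fun s => (differentiableOn_shiftedTransform hm hb hg (ι s)).mono fun z hz =>
      (hsub (hsub' hz)).1)
    (fun s z hz => ?_) (fun z _ => ?_) (fun z hz => hζ z (hsub (hsub' hz)).1)
  · obtain ⟨hzV, hzg⟩ := hsub (hsub' hz)
    rcases eq_or_ne z.re 0 with h0 | h0
    · rw [h0, abs_zero, zero_mul]; positivity
    · have h1 : |z.re| ≤ 1 := by
        have h2 := Complex.abs_re_le_norm (z - w)
        rw [Complex.sub_re, hw, sub_zero] at h2
        rw [mem_ball, dist_eq_norm] at hz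
        exact h2.trans (hz.le.trans (min_le_right _ _))
      have h0' : 0 < |z.re| := abs_pos.2 h0
      calc |z.re| * ‖shiftedTransform ψ z (g z) (ι s)‖
          ≤ |z.re| * (‖g z‖ + M / |z.re|) := by gcongr; exact hbound z hzV h0 s
        _ = |z.re| * ‖g z‖ + M := by field_simp
        _ ≤ 1 * (‖g w‖ + 1) + M := by gcongr; exact le_of_lt hzg
        _ = _ := by ring
  · rintro ⟨B, hB⟩
    refine uniformContinuous_of_dist_le (K := Real.exp ‖z‖ * (‖z‖ * B + M) + 2 * B)
      fun s s' => ?_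
    rw [← hι.dist_eq]
    exact dist_shiftedTransform_le hm hb hM (hB s) (hB s')

/-! ### The two spectra. -/

theorem laplaceIntegral_congr {φ ψ : ℝ → X} (h : ∀ t, 0 < t → φ t = ψ t) (z : ℂ) :
    laplaceIntegral φ z = laplaceIntegral ψ z :=
  setIntegral_congr_fun measurableSet_Ioi fun t ht => by simp only [h t ht]

theorem translate_zero {Y : Type*} (φ : ℝ → Y) : translate φ 0 = φ := by
  ext t; rw [translate, add_zero]

theorem evalBUC_uniformLaplaceTransform (φ : LInftyHalfLine X) (z : rightHalfPlane) (s : ℝ≥0) :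
    evalBUC s (uniformLaplaceTransform φ z) = laplaceIntegral (translate φ s) z := rfl

theorem evalBUC_uniformCarlemanTransform (φ : LInftyLine X) (z : offImaginaryAxis) (s : ℝ) :
    evalBUC s (uniformCarlemanTransform φ z) = carlemanTransform (translate φ s) z := rfl

theorem carlemanTransform_of_pos (φ : ℝ → X) {z : offImaginaryAxis} (hz : 0 < (z : ℂ).re) :
    carlemanTransform φ z = laplaceIntegral φ z := by
  rw [carlemanTransform, if_pos hz, laplaceIntegral]

theorem carlemanTransform_translate_of_neg (φ : ℝ → X) {z : offImaginaryAxis}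
    (hz : (z : ℂ).re < 0) (s : ℝ) :
    carlemanTransform (translate φ s) z =
      -laplaceIntegral (translate (fun t => φ (-t)) (-s)) (-(z : ℂ)) := by
  rw [carlemanTransform, if_neg hz.not_gt, laplaceIntegral]
  simp [translate, neg_add_rev, add_comm]

/-- Both branches obey the same shift formula, so a single extension `g` serves both sides of the
axis. -/
theorem carlemanTransform_translate_eq (φ : LInftyLine X) (z : offImaginaryAxis) (s : ℝ) :
    carlemanTransform (translate φ s) z =
      shiftedTransform φ z (carlemanTransform φ z) s := by
  have hm := Lp.aestronglyMeasurable φ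
  have hb := ae_norm_le_of_Lp φ
  rcases lt_or_gt_of_ne (show (z : ℂ).re ≠ 0 from z.2) with hz | hz
  · have h0 := carlemanTransform_translate_of_neg φ hz 0
    rw [translate_zero, neg_zero, translate_zero] at h0
    rw [carlemanTransform_translate_of_neg _ hz, h0, neg_laplaceIntegral_translate_eq hm hb hz]
  · rw [carlemanTransform_of_pos _ hz, carlemanTransform_of_pos _ hz,
      laplaceIntegral_translate_eq hm hb hz]

theorem norm_carlemanTransform_translate_le (φ : LInftyLine X) (z : offImaginaryAxis) (s : ℝ) :
    ‖carlemanTransform (translate φ s) z‖ ≤ (eLpNorm φ ∞ volume).toReal / |(z : ℂ).re| := by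
  have hb := ae_norm_le_of_Lp φ
  rcases lt_or_gt_of_ne (show (z : ℂ).re ≠ 0 from z.2) with hz | hz
  · rw [carlemanTransform_translate_of_neg _ hz, abs_of_neg hz]
    exact norm_neg_laplaceIntegral_translate_le hb hz s
  · rw [carlemanTransform_of_pos _ hz, abs_of_pos hz]
    exact norm_laplaceIntegral_translate_le hb hz s

theorem isRegularPoint_uniformCarlemanTransform_iff [CompleteSpace X] (φ : LInftyLine X) {w : ℂ}
    (hw : w.re = 0) :
    IsRegularPoint (uniformCarlemanTransform φ) w ↔
      IsRegularPoint (carlemanTransform (φ : ℝ → X)) w := by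
  constructor
  · intro h
    simpa only [evalBUC_uniformCarlemanTransform, translate_zero] using h.of_evalBUC (0 : ℝ)
  · rintro ⟨V, hV, hwV, g, hg, hgφ⟩
    have hζ : ∀ z : offImaginaryAxis, (z : ℂ) ∈ V → ∀ s : ℝ,
        carlemanTransform (translate φ s) z = shiftedTransform φ z (g z) s := by
      intro z hz s
      rw [carlemanTransform_translate_eq, hgφ z hz]
    refine isRegularPoint_of_shiftedTransform (ι := id) isometry_id
      (Lp.aestronglyMeasurable φ) (ae_norm_le_of_Lp φ) ENNReal.toReal_nonneg hw hV hwV hg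
      (fun z hz h0 s => ?_) (fun z hz s => hζ z hz s)
    rw [id, ← hζ ⟨z, h0⟩ hz s]
    exact (norm_carlemanTransform_translate_le φ ⟨z, h0⟩ s).trans
      (le_add_of_nonneg_left (norm_nonneg _))

/-- Unlike in the Carleman case, `g` is not a transform in the left half-plane, and the growth bound
there needs a separate argument using `s ≥ 0`. -/
theorem isRegularPoint_uniformLaplaceTransform_iff [CompleteSpace X] (φ : LInftyHalfLine X)
    {w : ℂ} (hw : w.re = 0) :
    IsRegularPoint (uniformLaplaceTransform φ) w ↔
      IsRegularPoint (laplaceTransform (φ : ℝ → X)) w := by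
  constructor
  · intro h
    have h0 := h.of_evalBUC (0 : ℝ≥0)
    simp only [evalBUC_uniformLaplaceTransform, NNReal.coe_zero, translate_zero] at h0
    exact h0
  · rintro ⟨V, hV, hwV, g, hg, hgφ⟩
    -- Extension by zero to the line. Its left transform vanishes (`hψneg`), so `shiftedTransform ψ
    -- z 0 s` is the left transform of the translate `ψ_s`.
    obtain ⟨ψ, hψ⟩ : ∃ ψ, ψ = (Ici (0 : ℝ)).indicator φ := ⟨_, rfl⟩
    obtain ⟨M, hMdef⟩ : ∃ M, M = (eLpNorm φ ∞ ((volume : Measure ℝ).restrict (Ici 0))).toReal :=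
      ⟨_, rfl⟩
    have hM : 0 ≤ M := hMdef ▸ ENNReal.toReal_nonneg
    have hm : AEStronglyMeasurable ψ := by
      rw [hψ, aestronglyMeasurable_indicator_iff measurableSet_Ici]
      exact Lp.aestronglyMeasurable φ
    have hb : ∀ᵐ t, ‖ψ t‖ ≤ M := by
      have h1 := ae_norm_le_of_Lp φ
      rw [ae_restrict_iff' measurableSet_Ici] at h1
      filter_upwards [h1] with t ht
      by_cases h0 : t ∈ Ici (0 : ℝ)
      · rw [hψ, indicator_of_mem h0, hMdef]; exact ht h0
      · rwa [hψ, indicator_of_notMem h0, norm_zero]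
    have hψφ : ∀ s : ℝ≥0, ∀ z, laplaceIntegral (translate φ s) z =
        laplaceIntegral (translate ψ s) z := fun s z => laplaceIntegral_congr (fun t ht => by
      have hts : t + (s : ℝ) ∈ Ici (0 : ℝ) := add_nonneg ht.le s.2
      rw [translate, translate, hψ, indicator_of_mem hts]) z
    have hψneg : ∀ z, -laplaceIntegral (fun t => ψ (-t)) (-z) = 0 := by
      intro z
      rw [laplaceIntegral_congr (ψ := fun _ => 0) (fun t ht => by
        rw [hψ, indicator_of_notMem (by simpa using ht)]), laplaceIntegral]
      simp
    have hζ : ∀ z ∈ V, 0 < z.re → ∀ s : ℝ≥0,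
        laplaceIntegral (translate φ s) z = shiftedTransform ψ z (g z) s := by
      intro z hz h0 s
      have h1 := hψφ 0 z
      rw [NNReal.coe_zero, translate_zero, translate_zero] at h1
      rw [hψφ, laplaceIntegral_translate_eq hm hb h0, ← h1, hgφ ⟨z, h0⟩ hz, laplaceTransform]
    refine isRegularPoint_of_shiftedTransform (ι := ((↑) : ℝ≥0 → ℝ)) isometry_subtype_coe hm hb hM
      hw hV hwV hg (fun z hz h0 s => ?_) (fun z hz s => hζ z hz z.2 s)
    rcases lt_or_gt_of_ne h0 with h0 | h0
    -- The first term is at most `‖g z‖` because `Re z < 0 ≤ s`. The second is a left transform,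
    -- bounded by `M / |Re z|`.
    · have hsplit : shiftedTransform ψ z (g z) s =
          Complex.exp (z * (s : ℝ)) • g z + shiftedTransform ψ z 0 s := by
        rw [shiftedTransform, shiftedTransform, zero_sub, sub_eq_add_neg, smul_add]
      have hexp : ‖Complex.exp (z * (s : ℝ))‖ ≤ 1 := by
        rw [Complex.norm_exp, Complex.re_mul_ofReal]
        exact Real.exp_le_one_iff.2 (mul_nonpos_of_nonpos_of_nonneg h0.le s.2)
      rw [hsplit, ← hψneg z, ← neg_laplaceIntegral_translate_eq hm hb h0, abs_of_neg h0]
      refine (norm_add_le _ _).trans (add_le_add ?_ ?_)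
      · rw [norm_smul]
        exact mul_le_of_le_one_left (norm_nonneg _) hexp
      · exact norm_neg_laplaceIntegral_translate_le hb h0 s
    · rw [← hζ z hz h0, hψφ, abs_of_pos h0]
      exact (norm_laplaceIntegral_translate_le hb h0 s).trans
        (le_add_of_nonneg_left (norm_nonneg _))

end UniformSpectra

end

theorem proposition4p2 {X : Type*} [NormedAddCommGroup X] [NormedSpace ℂ X] [CompleteSpace X] :
    (∀ φ : UniformSpectra.LInftyHalfLine X,
      UniformSpectra.laplaceSpectrum φ = UniformSpectra.uniformLaplaceSpectrum φ) ∧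
    (∀ φ : UniformSpectra.LInftyLine X,
      UniformSpectra.carlemanSpectrum φ = UniformSpectra.uniformCarlemanSpectrum φ) := by
  refine ⟨fun φ => ?_, fun φ => ?_⟩ <;> ext ω <;> refine not_congr (Iff.symm ?_)
  · exact UniformSpectra.isRegularPoint_uniformLaplaceTransform_iff φ (by simp)
  · exact UniformSpectra.isRegularPoint_uniformCarlemanTransform_iff φ (by simp)
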